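/- Let $P$ be a probability measure on $\mathbb{R}^d$ and let $X_1, X_2, \ldots$ be i.i.d. random vectors with law $P$; let $P_n = \frac1n\sum_{i=1}^n \delta_{X_i}$. Write $Rf=\int f\,dR$. Let $f_1,\dots,f_k$ be real measurable functions on $\mathbb{R}^d$ such that $1, f_1,\dots,f_k$ are linearly independent modulo equality $P$-almost everywhere, with an envelope $F$ (that is, $|f_i|\le F$ for all $i$) satisfying $PF^2<\infty$. Let $a_1,\dots,a_k\in\mathbb{R}$ and let $$\Omega=\Big\{Q \text{ signed measure on } \mathbb{R}^d:\ Q(\mathbb{R}^d)=1,\ \int |f_i|\,d|Q|<\infty,\ \int f_i\,dQ=a_i,\ 1\le i\le k\Big\}.$$ For a signed measure $Q$ and a measure $R$ put $\chi^2(Q,R)=\int\big(\frac{dQ}{dR}-1\big)^2dR$ if $Q\ll R$ and $\chi^2(Q,R)=\infty$ otherwise. Let $\Lambda_n$ be the set of signed measures of total mass $1$ carried by $\{X_1,\dots,X_n\}$ and let $$\chi_n^2=\inf_{Q\in\Omega\cap\Lambda_n}\chi^2(Q,P_n)\in[0,\infty],\qquad \inf\emptyset=\infty.$$ Fix any $Q_0\in\Omega$,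 let $\nu_n\in\mathbb{R}^k$ have entries $(Q_0-P_n)f_i$, and let $S_n$ be the $k\times k$ empirical covariance matrix with entries $P_n(f_if_j)-P_nf_i\,P_nf_j$. **Theorem.** Suppose that $P\in\Omega$ (the hypothesis $H_0$). For every $n\ge1$, $\chi_n^2=\nu_n'S_n^{-1}\nu_n$ whenever $S_n$ is invertible; almost surely, $S_n$ is invertible for all sufficiently large $n$; and $$n\chi_n^2\ \overset{d}{\longrightarrow}\ \chi^2(k),\qquad n\,\nu_n'S_n^{-1}\nu_n\ \overset{d}{\longrightarrow}\ \chi^2(k),$$ where $\chi^2(k)$ is the chi-square distribution with $k$ degrees of freedom (the law of the sum of the squares of $k$ independent standard normal variables), and where in the second statement $S_n^{-1}$ is read as $0$ when $S_n$ is singular. -/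

import Mathlib

open MeasureTheory ProbabilityTheory Filter
open scoped ENNReal Matrix

namespace ChiSquareTest

noncomputable section

/-- The set `Ω` of signed measures of total mass one on `ℝ^d` that integrate `f₁, …, f_k` and
satisfy the linear constraints `∫ f i dQ = a i`. -/
def constraintSet {d k : ℕ} (f : Fin k → EuclideanSpace ℝ (Fin d) → ℝ) (a : Fin k → ℝ) :
    Set (SignedMeasure (EuclideanSpace ℝ (Fin d))) :=
  {Q | Q Set.univ = 1 ∧ ∀ i, Q.Integrable (f i) ∧ ∫ᵛ x, f i x ∂<•Q = a i}

open Classical in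
/-- The divergence `χ²(Q, P) = ∫ (dQ/dP - 1)² dP` if `Q` is absolutely continuous with respect
to `P`, and `∞` otherwise. -/
def chiSqDiv {d : ℕ} (Q : SignedMeasure (EuclideanSpace ℝ (Fin d)))
    (P : Measure (EuclideanSpace ℝ (Fin d))) : ℝ≥0∞ :=
  if Q ≪ᵥ P.toENNRealVectorMeasure then
    ∫⁻ x, ENNReal.ofReal ((Q.rnDeriv P x - 1) ^ 2) ∂P
  else ∞

/-- The empirical measure `P_n = (1/n) ∑ δ_{x i}` of a sample of size `n`. -/
def empiricalMeasure {d n : ℕ} (x : Fin n → EuclideanSpace ℝ (Fin d)) :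
    Measure (EuclideanSpace ℝ (Fin d)) :=
  (n : ℝ≥0∞)⁻¹ • ∑ i, Measure.dirac (x i)

/-- The set `Λ_n` of signed measures of total mass one that are carried by the sample. -/
def sampleMeasures {d n : ℕ} (x : Fin n → EuclideanSpace ℝ (Fin d)) :
    Set (SignedMeasure (EuclideanSpace ℝ (Fin d))) :=
  {Q | Q Set.univ = 1 ∧ Q.variation (Set.range x)ᶜ = 0}

/-- The estimate `χ²_n = inf {χ²(Q, P_n) : Q ∈ Ω ∩ Λ_n}`, equal to `∞` if `Ω ∩ Λ_n` is empty. -/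
def chiSqEst {d k n : ℕ} (f : Fin k → EuclideanSpace ℝ (Fin d) → ℝ) (a : Fin k → ℝ)
    (x : Fin n → EuclideanSpace ℝ (Fin d)) : ℝ≥0∞ :=
  ⨅ Q ∈ constraintSet f a ∩ sampleMeasures x, chiSqDiv Q (empiricalMeasure x)

/-- The vector `ν_n` with entries `(Q₀ - P_n) f_i`. -/
def nuVec {d k n : ℕ} (f : Fin k → EuclideanSpace ℝ (Fin d) → ℝ)
    (Q₀ : SignedMeasure (EuclideanSpace ℝ (Fin d)))
    (x : Fin n → EuclideanSpace ℝ (Fin d)) : Fin k → ℝ :=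
  fun i => (∫ᵛ y, f i y ∂<•Q₀) - (∫ y, f i y ∂(empiricalMeasure x))

/-- The empirical covariance matrix `S_n` with entries `P_n f_i f_j - P_n f_i P_n f_j`. -/
def empCov {d k n : ℕ} (f : Fin k → EuclideanSpace ℝ (Fin d) → ℝ)
    (x : Fin n → EuclideanSpace ℝ (Fin d)) : Matrix (Fin k) (Fin k) ℝ :=
  Matrix.of fun i j => (∫ y, f i y * f j y ∂(empiricalMeasure x)) -
    (∫ y, f i y ∂(empiricalMeasure x)) * (∫ y, f j y ∂(empiricalMeasure x))

/-- The quadratic form `ν_n' S_n⁻¹ ν_n`. (The inverse is `0` if `S_n` is singular.) -/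
def quadStat {d k n : ℕ} (f : Fin k → EuclideanSpace ℝ (Fin d) → ℝ)
    (Q₀ : SignedMeasure (EuclideanSpace ℝ (Fin d)))
    (x : Fin n → EuclideanSpace ℝ (Fin d)) : ℝ :=
  nuVec f Q₀ x ⬝ᵥ ((empCov f x)⁻¹ *ᵥ nuVec f Q₀ x)

/-- The functions `1, f₁, …, f_k` are linearly independent modulo equality `P`-almost everywhere. -/
def LinIndepWithOne {d k : ℕ} (P : Measure (EuclideanSpace ℝ (Fin d)))
    (f : Fin k → EuclideanSpace ℝ (Fin d) → ℝ) : Prop :=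
  ∀ (c₀ : ℝ) (c : Fin k → ℝ), (∀ᵐ x ∂P, c₀ + ∑ i, c i * f i x = 0) → c₀ = 0 ∧ ∀ i, c i = 0

/-- The chi-square distribution with `k` degrees of freedom: the law of the sum of the squares of
`k` independent standard normal variables. -/
def chiSquareMeasure (k : ℕ) : Measure ℝ :=
  (Measure.pi fun _ : Fin k => gaussianReal 0 1).map fun z => ∑ i, z i ^ 2

instance chiSquareMeasure.instIsProbabilityMeasure (k : ℕ) :
    IsProbabilityMeasure (chiSquareMeasure k) :=
  Measure.isProbabilityMeasure_map (Measurable.aemeasurable (by fun_prop))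

/-- The first `n` observations of a sequence of observations. -/
def sample {S : Type*} {d : ℕ} (X : ℕ → S → EuclideanSpace ℝ (Fin d)) (n : ℕ) (ω : S) :
    Fin n → EuclideanSpace ℝ (Fin d) :=
  fun i => X i ω

end

end ChiSquareTest

/-!
The formula for the estimate is a duality for a quadratic program in finite dimension. A signed
measure carried by the sample and absolutely continuous with respect to `P_n` is given by its
density `h`, and it is feasible when `h - 1` has `P_n`-mean zero and
`P_n ((h - 1) f_i) = a_i - P_n f_i`. Minimising `P_n (h - 1)²` under these constraints is a
projection problem, solved by the combination `h - 1 = ∑ v_i (f_i - P_n f_i)` with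
`S_n v = a - P_n f`, and the minimum is `v' S_n v`; this is `chiSqEst_eq_of_isUnit` when `S_n` is
invertible. In general the estimate is the supremum over `v` of `2 v'(a - P_n f) - v' S_n v`
(`chiSqEst_eq_iSup`); the supremum is infinite when `a - P_n f` is outside the range of `S_n`, that
is, when there is no feasible measure. This formula makes the estimate a measurable function of
the sample for every `n`, as convergence in distribution requires (`measurable_chiSqEst`).

For the limit, let `Σ = B Bᵀ` be the covariance matrix of the `f_i` under `P`, which is positive
definite because `1, f_1, …, f_k` are linearly independent. By the strong law `S_n` tends to `Σ`
almost surely, so it is invertible for large `n` and its inverse tends to `Σ⁻¹`. The vectors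
`B⁻¹ (a - f (X_i))` are centred under the null hypothesis and have the identity as covariance
matrix. By a central limit theorem in several dimensions (`tendstoInDistribution_stdGaussian`,
from the one-dimensional theorem and Lévy's convergence theorem) their normalised sums `W_n`
converge to a standard Gaussian vector `Z`. Since `n ν_n' S_n⁻¹ ν_n = (B W_n)' S_n⁻¹ (B W_n)`,
Slutsky's theorem gives the limit `(B Z)' Σ⁻¹ (B Z) = |Z|²`, whose law is chi-square
(`tendstoInDistribution_quadForm`). Finally `n χ_n²` agrees with this statistic for all large `n`
almost surely, hence has the same limit (`tendstoInDistribution_of_eventuallyEq`).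
-/

open MeasureTheory ProbabilityTheory Filter
open scoped ENNReal Matrix

namespace ChiSquareTest

/-! ### Covariance matrices -/

/-- The covariance matrix of the functions `f i` under the measure `ρ`. -/
noncomputable def covMatrix {α : Type*} [MeasurableSpace α] {k : ℕ} (f : Fin k → α → ℝ)
    (ρ : Measure α) : Matrix (Fin k) (Fin k) ℝ :=
  Matrix.of fun i j => (∫ y, f i y * f j y ∂ρ) - (∫ y, f i y ∂ρ) * (∫ y, f j y ∂ρ)

/-- The linear combination `∑ v i * (f i - ρ f i)` of the functions `f i`, centred under `ρ`. -/
noncomputable def centredComb {α : Type*} [MeasurableSpace α] {k : ℕ} (f : Fin k → α → ℝ)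
    (ρ : Measure α) (v : Fin k → ℝ) (y : α) : ℝ :=
  ∑ i, v i * (f i y - ∫ z, f i z ∂ρ)

section Covariance

variable {α : Type*} [MeasurableSpace α] {k : ℕ} {f : Fin k → α → ℝ} {ρ : Measure α}

lemma memLp_centredComb [IsProbabilityMeasure ρ] (hf : ∀ i, MemLp (f i) 2 ρ) (v : Fin k → ℝ) :
    MemLp (centredComb f ρ v) 2 ρ :=
  memLp_finsetSum _ fun i _ => ((hf i).sub (memLp_const _)).const_mul (v i)

lemma integral_centredComb [IsProbabilityMeasure ρ] (hf : ∀ i, MemLp (f i) 2 ρ)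
    (v : Fin k → ℝ) : ∫ y, centredComb f ρ v y ∂ρ = 0 := by
  have hi i : Integrable (f i) ρ := (hf i).integrable one_le_two
  simp only [centredComb]
  rw [integral_finsetSum]
  · refine Finset.sum_eq_zero fun i _ => ?_
    rw [integral_const_mul, integral_sub (hi i) (integrable_const _)]
    simp
  · exact fun i _ => ((hi i).sub (integrable_const _)).const_mul _

lemma integral_mul_centredComb [IsProbabilityMeasure ρ] (hf : ∀ i, MemLp (f i) 2 ρ)
    (v : Fin k → ℝ) (i : Fin k) :
    ∫ y, f i y * centredComb f ρ v y ∂ρ = (covMatrix f ρ *ᵥ v) i := by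
  have hi i : Integrable (f i) ρ := (hf i).integrable one_le_two
  have hij j : Integrable (fun y => f i y * f j y) ρ := (hf i).integrable_mul (hf j)
  have key : (fun y => f i y * centredComb f ρ v y) =
      fun y => ∑ j, (f i y * f j y - (∫ z, f j z ∂ρ) * f i y) * v j := by
    ext y
    simp only [centredComb, Finset.mul_sum]
    exact Finset.sum_congr rfl fun j _ => by ring
  rw [key, integral_finsetSum]
  · simp only [Matrix.mulVec, dotProduct, covMatrix, Matrix.of_apply]
    refine Finset.sum_congr rfl fun j _ => ?_
    rw [integral_mul_const, integral_sub (hij j) ((hi i).const_mul _), integral_const_mul]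
    ring
  · exact fun j _ => ((hij j).sub ((hi i).const_mul _)).mul_const _

lemma integral_centredComb_sq [IsProbabilityMeasure ρ] (hf : ∀ i, MemLp (f i) 2 ρ)
    (v : Fin k → ℝ) :
    ∫ y, centredComb f ρ v y ^ 2 ∂ρ = v ⬝ᵥ (covMatrix f ρ *ᵥ v) := by
  have hg := memLp_centredComb hf v
  have key : (fun y => centredComb f ρ v y ^ 2) = fun y =>
      ∑ i, v i * (f i y * centredComb f ρ v y - (∫ z, f i z ∂ρ) * centredComb f ρ v y) := by
    ext y
    rw [sq]
    nth_rewrite 1 [centredComb]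
    rw [Finset.sum_mul]
    exact Finset.sum_congr rfl fun j _ => by ring
  have h1 i : Integrable (fun y => f i y * centredComb f ρ v y) ρ := (hf i).integrable_mul hg
  have h2 : Integrable (centredComb f ρ v) ρ := hg.integrable one_le_two
  rw [key, integral_finsetSum]
  · refine Finset.sum_congr rfl fun j _ => ?_
    rw [integral_const_mul, integral_sub (h1 j) (h2.const_mul _), integral_const_mul,
      integral_centredComb hf, integral_mul_centredComb hf]
    ring
  · exact fun j _ => ((h1 j).sub (h2.const_mul _)).const_mul _

end Covariance

/-! ### The empirical measure -/

section Empirical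

variable {d n : ℕ} {x : Fin n → EuclideanSpace ℝ (Fin d)}

lemma isProbabilityMeasure_empiricalMeasure (hn : 1 ≤ n) :
    IsProbabilityMeasure (empiricalMeasure x) := by
  constructor
  simp only [empiricalMeasure, Measure.smul_apply, Measure.finsetSum_apply, measure_univ,
    Finset.sum_const, Finset.card_univ, Fintype.card_fin, smul_eq_mul, nsmul_eq_mul, mul_one]
  exact ENNReal.inv_mul_cancel (by simpa using (by omega : n ≠ 0)) (ENNReal.natCast_ne_top n)

lemma integrable_empiricalMeasure (hn : 1 ≤ n) (g : EuclideanSpace ℝ (Fin d) → ℝ) :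
    Integrable g (empiricalMeasure x) := by
  refine Integrable.smul_measure ?_ (by simpa using (by omega : n ≠ 0))
  exact integrable_finsetSum_measure.2 fun i _ => integrable_dirac (by simp)

lemma memLp_two_empiricalMeasure (hn : 1 ≤ n) (g : EuclideanSpace ℝ (Fin d) → ℝ) :
    MemLp g 2 (empiricalMeasure x) :=
  (memLp_two_iff_integrable_sq (integrable_empiricalMeasure hn g).aestronglyMeasurable).2
    (integrable_empiricalMeasure hn _)

lemma integral_empiricalMeasure (g : EuclideanSpace ℝ (Fin d) → ℝ) :
    ∫ y, g y ∂(empiricalMeasure x) = (n : ℝ)⁻¹ * ∑ i, g (x i) := by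
  rw [empiricalMeasure, integral_smul_measure,
    integral_finsetSum_measure fun i _ => integrable_dirac (by simp)]
  simp [ENNReal.toReal_inv]

lemma empiricalMeasure_withDensityᵥ (hn : 1 ≤ n) (h : EuclideanSpace ℝ (Fin d) → ℝ) :
    (empiricalMeasure x).withDensityᵥ h =
      ∑ i, VectorMeasure.dirac (x i) ((n : ℝ)⁻¹ * h (x i)) := by
  ext s hs
  rw [withDensityᵥ_apply (integrable_empiricalMeasure hn h) hs, ← integral_indicator hs,
    integral_empiricalMeasure, Finset.mul_sum, FunLike.coe_sum, Finset.sum_apply]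
  refine Finset.sum_congr rfl fun i _ => ?_
  by_cases hx : x i ∈ s
  · simp [hx, hs]
  · simp [hx]

lemma integrable_empiricalMeasure_withDensityᵥ (hn : 1 ≤ n)
    (h g : EuclideanSpace ℝ (Fin d) → ℝ) :
    ((empiricalMeasure x).withDensityᵥ h).Integrable g := by
  rw [empiricalMeasure_withDensityᵥ hn]
  refine VectorMeasure.Integrable.finsetSum_vectorMeasure fun i _ => ?_
  rw [VectorMeasure.Integrable, VectorMeasure.variation_dirac]
  exact (integrable_dirac (by simp)).smul_measure (by finiteness)

lemma integral_empiricalMeasure_withDensityᵥ (hn : 1 ≤ n)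
    (h g : EuclideanSpace ℝ (Fin d) → ℝ) :
    ∫ᵛ y, g y ∂<•((empiricalMeasure x).withDensityᵥ h) =
      ∫ y, g y * h y ∂(empiricalMeasure x) := by
  rw [empiricalMeasure_withDensityᵥ hn, VectorMeasure.integral_finsetSum_vectorMeasure,
    integral_empiricalMeasure, Finset.mul_sum]
  · refine Finset.sum_congr rfl fun i _ => ?_
    rw [VectorMeasure.integral_dirac]
    simp
    ring
  · intro i _
    rw [VectorMeasure.Integrable, VectorMeasure.variation_dirac]
    exact (integrable_dirac (by simp)).smul_measure (by finiteness)

lemma variation_empiricalMeasure_withDensityᵥ (hn : 1 ≤ n)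
    (h : EuclideanSpace ℝ (Fin d) → ℝ) :
    ((empiricalMeasure x).withDensityᵥ h).variation (Set.range x)ᶜ = 0 := by
  have hm : MeasurableSet (Set.range x)ᶜ := (Set.finite_range x).measurableSet.compl
  rw [empiricalMeasure_withDensityᵥ hn]
  refine le_antisymm ((VectorMeasure.variation_finsetSum_le _ _ _).trans ?_) zero_le
  simp [Measure.finsetSum_apply, hm]

/-- The divergence of a signed measure with density `h` with respect to the empirical measure. -/
lemma chiSqDiv_empiricalMeasure_withDensityᵥ (hn : 1 ≤ n)
    (h : EuclideanSpace ℝ (Fin d) → ℝ) :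
    chiSqDiv ((empiricalMeasure x).withDensityᵥ h) (empiricalMeasure x) =
      ENNReal.ofReal (∫ y, (h y - 1) ^ 2 ∂(empiricalMeasure x)) := by
  have := isProbabilityMeasure_empiricalMeasure (x := x) hn
  have hh := SignedMeasure.eq_rnDeriv (μ := empiricalMeasure x)
    (s := (empiricalMeasure x).withDensityᵥ h) 0 h (integrable_empiricalMeasure hn h)
    VectorMeasure.MutuallySingular.zero_left (by simp)
  rw [chiSqDiv, if_pos (Measure.withDensityᵥ_absolutelyContinuous _ _),
    ofReal_integral_eq_lintegral_ofReal (integrable_empiricalMeasure hn _)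
      (ae_of_all _ fun y => sq_nonneg _)]
  refine lintegral_congr_ae ?_
  filter_upwards [hh] with y hy
  rw [hy]

end Empirical

/-! ### Duality for the estimate -/

section Duality

variable {d k n : ℕ} {f : Fin k → EuclideanSpace ℝ (Fin d) → ℝ} {a : Fin k → ℝ}
  {x : Fin n → EuclideanSpace ℝ (Fin d)}

lemma empCov_eq_covMatrix : empCov f x = covMatrix f (empiricalMeasure x) := rfl

/-- Weak duality: every `v` gives a lower bound for the divergence of a feasible measure. The bound
is the integral of the inequality `2 (h - 1) g - g² ≤ (h - 1)²`, where `h` is the density of the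
measure and `g` the centred linear combination of the `f i` with coefficients `v`. -/
lemma ofReal_le_chiSqDiv (hn : 1 ≤ n) {Q : SignedMeasure (EuclideanSpace ℝ (Fin d))}
    (hQ : Q ∈ constraintSet f a) (v : Fin k → ℝ) :
    ENNReal.ofReal (2 * (v ⬝ᵥ fun i => a i - ∫ y, f i y ∂(empiricalMeasure x)) -
      v ⬝ᵥ (empCov f x *ᵥ v)) ≤ chiSqDiv Q (empiricalMeasure x) := by
  have := isProbabilityMeasure_empiricalMeasure (x := x) hn
  by_cases hac : Q ≪ᵥ (empiricalMeasure x).toENNRealVectorMeasure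
  swap
  · simp [chiSqDiv, hac]
  obtain ⟨h, rfl⟩ : ∃ h, Q = (empiricalMeasure x).withDensityᵥ h :=
    ⟨_, (SignedMeasure.withDensityᵥ_rnDeriv_eq _ _ hac).symm⟩
  rw [chiSqDiv_empiricalMeasure_withDensityᵥ hn]
  refine ENNReal.ofReal_le_ofReal ?_
  have hi := integrable_empiricalMeasure (x := x) hn
  have hf i := memLp_two_empiricalMeasure (x := x) hn (f i)
  have hmass : ∫ y, h y ∂(empiricalMeasure x) = 1 := by
    have := hQ.1
    rwa [withDensityᵥ_apply (hi h) MeasurableSet.univ, Measure.restrict_univ] at this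
  have hmom i : ∫ y, f i y * h y ∂(empiricalMeasure x) = a i := by
    rw [← integral_empiricalMeasure_withDensityᵥ hn, (hQ.2 i).2]
  set g := centredComb f (empiricalMeasure x) v with hg
  have hcross : ∫ y, (h y - 1) * g y ∂(empiricalMeasure x) =
      v ⬝ᵥ fun i => a i - ∫ y, f i y ∂(empiricalMeasure x) := by
    have h1 : ∫ y, (h y - 1) * g y ∂(empiricalMeasure x) =
        ∫ y, h y * g y ∂(empiricalMeasure x) := by
      simp only [sub_mul, one_mul]
      rw [integral_sub (hi _) (hi _), hg, integral_centredComb hf, sub_zero]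
    have h2 : (fun y => h y * g y) = fun y =>
        ∑ i, v i * (f i y * h y - (∫ z, f i z ∂(empiricalMeasure x)) * h y) := by
      ext y
      simp only [hg, centredComb, Finset.mul_sum]
      exact Finset.sum_congr rfl fun j _ => by ring
    rw [h1, h2, integral_finsetSum _ fun _ _ => hi _]
    refine Finset.sum_congr rfl fun i _ => ?_
    rw [integral_const_mul, integral_sub (hi _) (hi _), integral_const_mul, hmom, hmass, mul_one]
  rw [← hcross, empCov_eq_covMatrix, ← integral_centredComb_sq hf, ← integral_const_mul,
    ← integral_sub (hi _) (hi _)]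
  refine integral_mono (hi _) (hi _) fun y => ?_
  simp only
  nlinarith [sq_nonneg ((h y - 1) - g y)]

/-- If `a - P_n f = S_n v`, the density `1 + ∑ v i * (f i - P_n f i)` gives a feasible measure whose
divergence equals `v' S_n v`. -/
lemma chiSqEst_le_of_mulVec_eq (hn : 1 ≤ n) {v : Fin k → ℝ}
    (hv : empCov f x *ᵥ v = fun i => a i - ∫ y, f i y ∂(empiricalMeasure x)) :
    chiSqEst f a x ≤ ENNReal.ofReal (v ⬝ᵥ (empCov f x *ᵥ v)) := by
  have := isProbabilityMeasure_empiricalMeasure (x := x) hn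
  have hi := integrable_empiricalMeasure (x := x) hn
  have hf i := memLp_two_empiricalMeasure (x := x) hn (f i)
  set g := centredComb f (empiricalMeasure x) v with hg
  set Q := (empiricalMeasure x).withDensityᵥ fun y => 1 + g y with hQ
  have hmass : Q Set.univ = 1 := by
    rw [hQ, withDensityᵥ_apply (hi _) MeasurableSet.univ, Measure.restrict_univ,
      integral_add (hi _) (hi _), hg, integral_centredComb hf]
    simp
  have hmem : Q ∈ constraintSet f a ∩ sampleMeasures x := by
    refine ⟨⟨hmass, fun i => ⟨integrable_empiricalMeasure_withDensityᵥ hn _ _, ?_⟩⟩,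
      hmass, variation_empiricalMeasure_withDensityᵥ hn _⟩
    rw [hQ, integral_empiricalMeasure_withDensityᵥ hn]
    simp only [mul_add, mul_one]
    rw [integral_add (hi _) (hi _), hg, integral_mul_centredComb hf, ← empCov_eq_covMatrix, hv]
    ring
  refine (iInf₂_le Q hmem).trans_eq ?_
  rw [hQ, chiSqDiv_empiricalMeasure_withDensityᵥ hn, empCov_eq_covMatrix,
    ← integral_centredComb_sq hf]
  simp [hg]

/-- A vector outside the range of a square matrix is detected by a vector on which the quadratic
form of the matrix vanishes. -/
lemma exists_dotProduct_ne_zero_of_notMem_range {M : Matrix (Fin k) (Fin k) ℝ} {u : Fin k → ℝ}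
    (hu : ¬ ∃ v, M *ᵥ v = u) : ∃ v, v ⬝ᵥ u ≠ 0 ∧ v ⬝ᵥ (M *ᵥ v) = 0 := by
  have hmem : u ∉ LinearMap.range M.mulVecLin := fun ⟨v, hv⟩ => hu ⟨v, hv⟩
  obtain ⟨φ, hφu, hφ⟩ := Submodule.exists_le_ker_of_notMem hmem
  have key w : (fun i => φ (Pi.single i 1)) ⬝ᵥ w = φ w := by
    rw [LinearMap.pi_apply_eq_sum_univ φ w]
    refine Finset.sum_congr rfl fun i _ => ?_
    have hi : (fun j => if i = j then (1 : ℝ) else 0) = Pi.single i 1 := by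
      ext j
      simp [Pi.single_apply, eq_comm]
    rw [smul_eq_mul, mul_comm, hi]
  refine ⟨fun i => φ (Pi.single i 1), by rwa [key], ?_⟩
  rw [key]
  exact hφ ⟨_, rfl⟩

/-- Strong duality: the estimate is the supremum of the concave quadratic functions
`v ↦ 2 v'(a - P_n f) - v' S_n v`, whether or not `S_n` is invertible. -/
theorem chiSqEst_eq_iSup (hn : 1 ≤ n) :
    chiSqEst f a x = ⨆ v : Fin k → ℝ,
      ENNReal.ofReal (2 * (v ⬝ᵥ fun i => a i - ∫ y, f i y ∂(empiricalMeasure x)) -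
        v ⬝ᵥ (empCov f x *ᵥ v)) := by
  refine le_antisymm ?_ (iSup_le fun v => le_iInf₂ fun Q hQ => ofReal_le_chiSqDiv hn hQ.1 v)
  set u : Fin k → ℝ := fun i => a i - ∫ y, f i y ∂(empiricalMeasure x) with hu
  by_cases hr : ∃ v, empCov f x *ᵥ v = u
  · obtain ⟨v, hv⟩ := hr
    refine (chiSqEst_le_of_mulVec_eq hn hv).trans (le_iSup_of_le v (ENNReal.ofReal_le_ofReal ?_))
    rw [hv]
    linarith
  · obtain ⟨v, hvu, hv⟩ := exists_dotProduct_ne_zero_of_notMem_range hr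
    -- along the line through `v` the quadratic function is linear and nonzero
    refine le_of_le_of_eq le_top (ENNReal.eq_top_of_forall_nnreal_le fun r => ?_).symm
    refine le_iSup_of_le (((r : ℝ) / (2 * (v ⬝ᵥ u))) • v) ?_
    rw [Matrix.mulVec_smul, smul_dotProduct, smul_dotProduct, dotProduct_smul, hv]
    simp only [smul_eq_mul, mul_zero, sub_zero]
    rw [show 2 * ((r : ℝ) / (2 * (v ⬝ᵥ u)) * (v ⬝ᵥ u)) = r by field_simp]
    simp

theorem chiSqEst_eq_of_isUnit (hn : 1 ≤ n) (hS : IsUnit (empCov f x)) :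
    chiSqEst f a x = ENNReal.ofReal
      ((fun i => a i - ∫ y, f i y ∂(empiricalMeasure x)) ⬝ᵥ
        ((empCov f x)⁻¹ *ᵥ fun i => a i - ∫ y, f i y ∂(empiricalMeasure x))) := by
  set u : Fin k → ℝ := fun i => a i - ∫ y, f i y ∂(empiricalMeasure x) with hu
  have hv : empCov f x *ᵥ ((empCov f x)⁻¹ *ᵥ u) = u := by
    rw [Matrix.mulVec_mulVec, Matrix.mul_nonsing_inv _ ((Matrix.isUnit_iff_isUnit_det _).1 hS),
      Matrix.one_mulVec]
  refine le_antisymm ((chiSqEst_le_of_mulVec_eq hn hv).trans_eq ?_) ?_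
  · rw [hv, dotProduct_comm]
  · rw [chiSqEst_eq_iSup hn]
    refine le_iSup_of_le ((empCov f x)⁻¹ *ᵥ u) (ENNReal.ofReal_le_ofReal ?_)
    rw [← hu, hv, dotProduct_comm]
    linarith

end Duality

/-! ### Convergence in distribution -/

section Convergence

variable {S : Type*} [MeasurableSpace S] {μ : Measure S} [IsProbabilityMeasure μ]

/-- The limit in a convergence in distribution can be replaced by any variable of the same law. -/
lemma tendstoInDistribution_of_map_eq {E S' S'' : Type*} [TopologicalSpace E]
    [MeasurableSpace E] [OpensMeasurableSpace E] [MeasurableSpace S'] [MeasurableSpace S'']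
    {μ' : Measure S'} [IsProbabilityMeasure μ'] {μ'' : Measure S''} [IsProbabilityMeasure μ'']
    {Y : ℕ → S → E} {Z : S' → E} {Z' : S'' → E}
    (h : TendstoInDistribution Y atTop Z (fun _ => μ) μ') (hZ' : AEMeasurable Z' μ'')
    (hmap : μ'.map Z = μ''.map Z') :
    TendstoInDistribution Y atTop Z' (fun _ => μ) μ'' where
  forall_aemeasurable := h.forall_aemeasurable
  aemeasurable_limit := hZ'
  tendsto := by
    convert! h.tendsto using 2
    exact congrArg nhds (Subtype.ext hmap.symm)

/-- Convergence in distribution is not affected by changing, for each sample point, finitely many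
terms of the sequence. -/
lemma tendstoInDistribution_of_eventuallyEq {E S' : Type*} [TopologicalSpace E]
    [MeasurableSpace E] [OpensMeasurableSpace E] [MeasurableSpace S'] {μ' : Measure S'}
    [IsProbabilityMeasure μ'] {Y Y' : ℕ → S → E} {Z : S' → E}
    (h : TendstoInDistribution Y atTop Z (fun _ => μ) μ')
    (hY' : ∀ n, AEMeasurable (Y' n) μ) (heq : ∀ᵐ ω ∂μ, ∀ᶠ n in atTop, Y n ω = Y' n ω) :
    TendstoInDistribution Y' atTop Z (fun _ => μ) μ' where
  forall_aemeasurable := hY'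
  aemeasurable_limit := h.aemeasurable_limit
  tendsto := by
    have hlim := ProbabilityMeasure.tendsto_iff_forall_integral_tendsto.1 h.tendsto
    refine ProbabilityMeasure.tendsto_iff_forall_integral_tendsto.2 fun g => ?_
    have hY := h.forall_aemeasurable
    have hgm : Measurable g := g.continuous.measurable
    have hmap {W : S → E} (hW : AEMeasurable W μ) : ∫ y, g y ∂(μ.map W) = ∫ ω, g (W ω) ∂μ :=
      MeasureTheory.integral_map hW hgm.aestronglyMeasurable
    have hint {W : S → E} (hW : AEMeasurable W μ) : Integrable (fun ω => g (W ω)) μ :=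
      Integrable.of_bound (hgm.comp_aemeasurable hW).aestronglyMeasurable ‖g‖
        (ae_of_all _ fun ω => g.norm_coe_le_norm _)
    have hdiff : Tendsto (fun n => ∫ ω, (g (Y' n ω) - g (Y n ω)) ∂μ) atTop (nhds 0) := by
      have := tendsto_integral_of_dominated_convergence (μ := μ)
        (F := fun n ω => g (Y' n ω) - g (Y n ω)) (f := fun _ => 0) (fun _ => ‖g‖ + ‖g‖)
        (fun n => ((hint (hY' n)).sub (hint (hY n))).aestronglyMeasurable)
        (integrable_const _)
        (fun n => ae_of_all _ fun ω => (norm_sub_le _ _).trans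
          (add_le_add (g.norm_coe_le_norm _) (g.norm_coe_le_norm _)))
        (by
          filter_upwards [heq] with ω hω
          refine tendsto_const_nhds.congr' ?_
          filter_upwards [hω] with n hn
          rw [hn, sub_self])
      simpa using this
    have hsum := (hlim g).add hdiff
    rw [add_zero] at hsum
    refine hsum.congr fun n => ?_
    simp only [ProbabilityMeasure.coe_mk]
    rw [hmap (hY n), hmap (hY' n), integral_sub (hint (hY' n)) (hint (hY n))]
    ring

open scoped RealInnerProductSpace in
/-- The central limit theorem for independent, identically distributed, centred, isotropic random
vectors of a Euclidean space, obtained from the one-dimensional theorem by Lévy's convergence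
theorem: the characteristic function at `t` only involves the projection on `t`. -/
theorem tendstoInDistribution_stdGaussian {E : Type*} [NormedAddCommGroup E]
    [InnerProductSpace ℝ E] [FiniteDimensional ℝ E] [MeasurableSpace E] [BorelSpace E]
    {Y : ℕ → S → E} (hY : MemLp (Y 0) 2 μ) (hindep : iIndepFun Y μ)
    (hident : ∀ i, IdentDistrib (Y i) (Y 0) μ μ)
    (h0 : ∀ t : E, ∫ ω, ⟪Y 0 ω, t⟫ ∂μ = 0) (h1 : ∀ t : E, ∫ ω, ⟪Y 0 ω, t⟫ ^ 2 ∂μ = ‖t‖ ^ 2) :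
    TendstoInDistribution (fun (n : ℕ) ω => (√n)⁻¹ • ∑ i ∈ Finset.range n, Y i ω) atTop id
      (fun _ => μ) (stdGaussian E) where
  forall_aemeasurable n := by
    have := fun i => (hident i).aemeasurable_fst
    fun_prop
  tendsto := by
    refine ProbabilityMeasure.tendsto_iff_tendsto_charFun.2 fun t => ?_
    have hm i : AEMeasurable (Y i) μ := (hident i).aemeasurable_fst
    have hmem : MemLp (fun ω => ⟪Y 0 ω, t⟫) 2 μ := hY.inner_const t
    have hvar : Var[fun ω => ⟪Y 0 ω, t⟫; μ] = ‖t‖ ^ 2 := by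
      rw [variance_eq_sub hmem]
      simp [h0, h1]
    have hclt := tendstoInDistribution_inv_sqrt_mul_sum_sub (X := fun i ω => ⟪Y i ω, t⟫) (P := μ)
      (P' := gaussianReal 0 (‖t‖ ^ 2).toNNReal) (Y := id) (by rw [hvar]; exact HasLaw.id) hmem
      (hindep.comp (fun _ y => ⟪y, t⟫) fun _ => by fun_prop)
      fun i => (hident i).comp (u := fun y => ⟪y, t⟫) (by fun_prop)
    have hchar := (ProbabilityMeasure.tendsto_iff_tendsto_charFun.1 hclt.tendsto) 1
    simp only [ProbabilityMeasure.coe_mk, Measure.map_id, charFun_stdGaussian,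
      charFun_gaussianReal] at hchar ⊢
    convert hchar using 2 with n
    · rw [charFun_apply, charFun_apply,
        MeasureTheory.integral_map (by fun_prop) (by fun_prop),
        MeasureTheory.integral_map (by fun_prop) (by fun_prop)]
      simp [h0, real_inner_smul_left, sum_inner]
    · simp [neg_div]

end Convergence

lemma map_id_chiSquareMeasure (k : ℕ) :
    (stdGaussian (EuclideanSpace ℝ (Fin k))).map (fun z => ∑ i, z i ^ 2) =
      (chiSquareMeasure k).map id := by
  rw [← map_pi_eq_stdGaussian, Measure.map_map (by fun_prop) (by fun_prop), Measure.map_id]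
  rfl

/-! ### Matrix lemmas -/

lemma exists_eq_mul_transpose {k : ℕ} {M : Matrix (Fin k) (Fin k) ℝ} (hM : M.PosDef) :
    ∃ B : Matrix (Fin k) (Fin k) ℝ, IsUnit B.det ∧ M = B * Bᵀ := by
  open scoped MatrixOrder in
  obtain ⟨C, hC⟩ := CStarAlgebra.nonneg_iff_eq_star_mul_self.mp hM.posSemidef.nonneg
  rw [Matrix.star_eq_conjTranspose, Matrix.conjTranspose_eq_transpose_of_trivial] at hC
  refine ⟨Cᵀ, ?_, by simpa using hC⟩
  have := hM.det_pos
  rw [hC, Matrix.det_mul] at this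
  exact isUnit_iff_ne_zero.2 fun h => by simp [h] at this

lemma measurable_matrix_inv {k : ℕ} :
    Measurable fun M : Fin k → Fin k → ℝ => fun i j => (Matrix.of M)⁻¹ i j := by
  have h1 : Continuous fun M : Fin k → Fin k → ℝ => (Matrix.of M).det :=
    Continuous.matrix_det continuous_id
  have h2 : Continuous fun M : Fin k → Fin k → ℝ => (Matrix.of M).adjugate :=
    Continuous.matrix_adjugate continuous_id
  refine measurable_pi_lambda _ fun i => measurable_pi_lambda _ fun j => ?_
  have : (fun M : Fin k → Fin k → ℝ => (Matrix.of M)⁻¹ i j) =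
      fun M => (Matrix.of M).det⁻¹ * (Matrix.of M).adjugate i j := by
    ext M
    simp [Matrix.inv_def]
  rw [this]
  exact h1.measurable.inv.mul ((continuous_apply j).comp ((continuous_apply i).comp h2)).measurable

/-! ### Measurability of the statistics -/

section Measurability

variable {d k n : ℕ} {f : Fin k → EuclideanSpace ℝ (Fin d) → ℝ}

lemma measurable_integral_empiricalMeasure {g : EuclideanSpace ℝ (Fin d) → ℝ}
    (hg : Measurable g) :
    Measurable fun x : Fin n → EuclideanSpace ℝ (Fin d) => ∫ y, g y ∂(empiricalMeasure x) := by
  simp only [integral_empiricalMeasure]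
  fun_prop

lemma measurable_empCov (hf : ∀ i, Measurable (f i)) (i j : Fin k) :
    Measurable fun x : Fin n → EuclideanSpace ℝ (Fin d) => empCov f x i j :=
  (measurable_integral_empiricalMeasure ((hf i).mul (hf j))).sub
    ((measurable_integral_empiricalMeasure (hf i)).mul
      (measurable_integral_empiricalMeasure (hf j)))

/-- The estimate is a measurable function of the sample, also where `S_n` is singular: in the dual
formula the supremum may be restricted to a countable dense set. -/
lemma measurable_chiSqEst (hf : ∀ i, Measurable (f i)) (a : Fin k → ℝ) :
    Measurable fun x : Fin n → EuclideanSpace ℝ (Fin d) => chiSqEst f a x := by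
  rcases Nat.eq_zero_or_pos n with rfl | hn
  · exact Subsingleton.measurable
  set φ : (Fin k → ℝ) → (Fin n → EuclideanSpace ℝ (Fin d)) → ℝ≥0∞ := fun v x =>
    ENNReal.ofReal (2 * (v ⬝ᵥ fun i => a i - ∫ y, f i y ∂(empiricalMeasure x)) -
      v ⬝ᵥ (empCov f x *ᵥ v)) with hφ
  have hcont x : Continuous fun v => φ v x := by
    refine ENNReal.continuous_ofReal.comp ?_
    simp only [dotProduct, Matrix.mulVec]
    fun_prop
  have key : (fun x : Fin n → EuclideanSpace ℝ (Fin d) => chiSqEst f a x) =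
      fun x => ⨆ m : ℕ, φ (TopologicalSpace.denseSeq _ m) x := by
    ext x
    rw [chiSqEst_eq_iSup hn]
    refine le_antisymm (iSup_le fun v => ?_) (iSup_le fun m => le_iSup (fun v => φ v x) _)
    have hclosed : IsClosed {v | φ v x ≤ ⨆ m : ℕ, φ (TopologicalSpace.denseSeq _ m) x} :=
      isClosed_le (hcont x) continuous_const
    have hdense := TopologicalSpace.denseRange_denseSeq (Fin k → ℝ)
    have huniv := (hclosed.closure_subset_iff.2
      (Set.range_subset_iff.2 fun m => le_iSup (fun m => φ (TopologicalSpace.denseSeq _ m) x) m))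
    rw [hdense.closure_range] at huniv
    exact huniv (Set.mem_univ v)
  rw [key]
  refine Measurable.iSup fun m => ENNReal.measurable_ofReal.comp ?_
  simp only [dotProduct, Matrix.mulVec]
  have h1 i := measurable_integral_empiricalMeasure (n := n) (hf i)
  have h2 i j := measurable_empCov (n := n) hf i j
  fun_prop

end Measurability

/-! ### The sampling model -/

lemma integral_empiricalMeasure_sample {d : ℕ} {S : Type*}
    (X : ℕ → S → EuclideanSpace ℝ (Fin d)) (g : EuclideanSpace ℝ (Fin d) → ℝ) (n : ℕ) (ω : S) :
    ∫ y, g y ∂(empiricalMeasure (sample X n ω)) =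
      (n : ℝ)⁻¹ * ∑ i ∈ Finset.range n, g (X i ω) := by
  rw [integral_empiricalMeasure, Finset.sum_range]
  rfl

section Sampling

variable {d k : ℕ} {S : Type*} [MeasurableSpace S] {μ : Measure S}
  {P : Measure (EuclideanSpace ℝ (Fin d))}
  {X : ℕ → S → EuclideanSpace ℝ (Fin d)} {f : Fin k → EuclideanSpace ℝ (Fin d) → ℝ}

lemma memLp_two_of_envelope (hf : ∀ i, Measurable (f i)) {F : EuclideanSpace ℝ (Fin d) → ℝ}
    (hF : ∀ i x, |f i x| ≤ F x) (hF_sq : Integrable (fun x => F x ^ 2) P) (i : Fin k) :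
    MemLp (f i) 2 P := by
  rw [memLp_two_iff_integrable_sq (hf i).aestronglyMeasurable]
  refine hF_sq.mono' ((hf i).pow_const 2).aestronglyMeasurable (ae_of_all _ fun x => ?_)
  rw [Real.norm_eq_abs, abs_pow]
  exact pow_le_pow_left₀ (abs_nonneg _) (hF i x) 2

/-- A vanishing variance of `∑ v i * f i` would be an affine relation between the `f i`. -/
lemma posDef_covMatrix [IsProbabilityMeasure P] (hf : ∀ i, MemLp (f i) 2 P)
    (hind : LinIndepWithOne P f) : (covMatrix f P).PosDef := by
  refine Matrix.PosDef.of_dotProduct_mulVec_pos ?_ fun {v} hv => ?_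
  · ext i j
    simp [covMatrix, mul_comm]
  · rw [star_trivial, ← integral_centredComb_sq hf]
    have hnonneg : 0 ≤ fun y => centredComb f P v y ^ 2 := fun y => sq_nonneg _
    refine lt_of_le_of_ne (integral_nonneg hnonneg) fun h0 => hv ?_
    rw [eq_comm, integral_eq_zero_iff_of_nonneg hnonneg (memLp_centredComb hf v).integrable_sq]
      at h0
    refine funext (hind (-∑ i, v i * ∫ z, f i z ∂P) v ?_).2
    filter_upwards [h0] with y hy
    have hy' : centredComb f P v y = 0 := by simpa using hy
    rw [← hy']
    simp only [centredComb, mul_sub, Finset.sum_sub_distrib]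
    ring

lemma aemeasurable_sample (hX : ∀ i, HasLaw (X i) P μ) (n : ℕ) :
    AEMeasurable (sample X n) μ :=
  aemeasurable_pi_lambda _ fun i => (hX i).aemeasurable

lemma identDistrib_of_hasLaw (hX : ∀ i, HasLaw (X i) P μ) (i : ℕ) :
    IdentDistrib (X i) (X 0) μ μ :=
  ⟨(hX i).aemeasurable, (hX 0).aemeasurable, (hX i).map_eq.trans (hX 0).map_eq.symm⟩

lemma ae_tendsto_integral_empiricalMeasure (hX : ∀ i, HasLaw (X i) P μ) (hindep : iIndepFun X μ)
    {g : EuclideanSpace ℝ (Fin d) → ℝ} (hgm : Measurable g) (hg : Integrable g P) :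
    ∀ᵐ ω ∂μ, Tendsto (fun n => ∫ y, g y ∂(empiricalMeasure (sample X n ω))) atTop
      (nhds (∫ y, g y ∂P)) := by
  have hmap : ∫ ω, g (X 0 ω) ∂μ = ∫ y, g y ∂P := by
    rw [← (hX 0).map_eq, MeasureTheory.integral_map (hX 0).aemeasurable hgm.aestronglyMeasurable]
  have hint : Integrable (fun ω => g (X 0 ω)) μ := by
    rw [← (hX 0).map_eq] at hg
    exact hg.comp_aemeasurable (hX 0).aemeasurable
  have := strong_law_ae_real (fun i ω => g (X i ω)) hint
    (fun i j hij => (hindep.indepFun hij).comp hgm hgm)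
    fun i => (identDistrib_of_hasLaw hX i).comp hgm
  filter_upwards [this] with ω hω
  simp only [integral_empiricalMeasure_sample]
  rw [hmap] at hω
  simpa only [div_eq_inv_mul] using hω

lemma ae_tendsto_empCov [IsProbabilityMeasure P] (hX : ∀ i, HasLaw (X i) P μ)
    (hindep : iIndepFun X μ) (hfm : ∀ i, Measurable (f i)) (hf : ∀ i, MemLp (f i) 2 P) :
    ∀ᵐ ω ∂μ, Tendsto (fun n => empCov f (sample X n ω)) atTop (nhds (covMatrix f P)) := by
  have h1 : ∀ᵐ ω ∂μ, ∀ i, Tendsto (fun n => ∫ y, f i y ∂(empiricalMeasure (sample X n ω))) atTop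
      (nhds (∫ y, f i y ∂P)) := ae_all_iff.2 fun i =>
    ae_tendsto_integral_empiricalMeasure hX hindep (hfm i) ((hf i).integrable one_le_two)
  have h2 : ∀ᵐ ω ∂μ, ∀ i j,
      Tendsto (fun n => ∫ y, f i y * f j y ∂(empiricalMeasure (sample X n ω))) atTop
      (nhds (∫ y, f i y * f j y ∂P)) := ae_all_iff.2 fun i => ae_all_iff.2 fun j =>
    ae_tendsto_integral_empiricalMeasure hX hindep ((hfm i).mul (hfm j))
      ((hf i).integrable_mul (hf j))
  filter_upwards [h1, h2] with ω hω1 hω2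
  exact tendsto_pi_nhds.2 fun i => tendsto_pi_nhds.2 fun j =>
    (hω2 i j).sub ((hω1 i).mul (hω1 j))

lemma ae_eventually_isUnit_empCov [IsProbabilityMeasure P] (hX : ∀ i, HasLaw (X i) P μ)
    (hindep : iIndepFun X μ) (hfm : ∀ i, Measurable (f i)) (hf : ∀ i, MemLp (f i) 2 P)
    (hind : LinIndepWithOne P f) :
    ∀ᵐ ω ∂μ, ∀ᶠ n in atTop, IsUnit (empCov f (sample X n ω)) := by
  filter_upwards [ae_tendsto_empCov hX hindep hfm hf] with ω hω
  have hdet := ((continuous_id.matrix_det).tendsto (covMatrix f P)).comp hω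
  filter_upwards [hdet.eventually_ne (posDef_covMatrix hf hind).det_pos.ne'] with n hn
  exact (Matrix.isUnit_iff_isUnit_det _).2 (isUnit_iff_ne_zero.2 hn)

lemma ae_tendsto_empCov_inv [IsProbabilityMeasure P] (hX : ∀ i, HasLaw (X i) P μ)
    (hindep : iIndepFun X μ) (hfm : ∀ i, Measurable (f i)) (hf : ∀ i, MemLp (f i) 2 P)
    (hind : LinIndepWithOne P f) :
    ∀ᵐ ω ∂μ, Tendsto (fun n => (empCov f (sample X n ω))⁻¹) atTop
      (nhds (covMatrix f P)⁻¹) := by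
  filter_upwards [ae_tendsto_empCov hX hindep hfm hf] with ω hω
  have hdet := ((continuous_id.matrix_det).tendsto (covMatrix f P)).comp hω
  have hadj := ((continuous_id.matrix_adjugate).tendsto (covMatrix f P)).comp hω
  simp only [Matrix.inv_def, Ring.inverse_eq_inv']
  exact (hdet.inv₀ (posDef_covMatrix hf hind).det_pos.ne').smul hadj

end Sampling

/-! ### The limit law -/

/-- The vector `B⁻¹ (a - f y)`. If `f` has mean `a` and covariance matrix `B Bᵀ` under `P`, it is
centred and isotropic under `P`. -/
noncomputable def whiten {α : Type*} {k : ℕ} (f : Fin k → α → ℝ) (a : Fin k → ℝ)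
    (B : Matrix (Fin k) (Fin k) ℝ) (y : α) : EuclideanSpace ℝ (Fin k) :=
  WithLp.toLp 2 (B⁻¹ *ᵥ fun i => a i - f i y)

section Whiten

variable {α : Type*} [MeasurableSpace α] {k : ℕ} {P : Measure α}
  {f : Fin k → α → ℝ} {a : Fin k → ℝ} {B : Matrix (Fin k) (Fin k) ℝ}

lemma measurable_whiten (hf : ∀ i, Measurable (f i)) : Measurable (whiten f a B) := by
  refine (WithLp.measurable_toLp 2 _).comp (measurable_pi_lambda _ fun i => ?_)
  simp only [Matrix.mulVec, dotProduct]
  fun_prop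

lemma memLp_whiten [IsFiniteMeasure P] (hf : ∀ i, MemLp (f i) 2 P) : MemLp (whiten f a B) 2 P := by
  refine MemLp.of_eval_piLp fun i => ?_
  change MemLp (fun y => ∑ j, B⁻¹ i j * (a j - f j y)) 2 P
  exact memLp_finsetSum _ fun j _ => ((memLp_const (a j)).sub (hf j)).const_mul (B⁻¹ i j)

open scoped RealInnerProductSpace in
lemma inner_whiten (ha : ∀ i, ∫ y, f i y ∂P = a i) (t : EuclideanSpace ℝ (Fin k)) (y : α) :
    ⟪whiten f a B y, t⟫ = - centredComb f P ((B⁻¹)ᵀ *ᵥ t.ofLp) y := by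
  rw [EuclideanSpace.inner_eq_star_dotProduct, star_trivial, whiten, Matrix.dotProduct_mulVec,
    ← Matrix.mulVec_transpose, centredComb, dotProduct, ← Finset.sum_neg_distrib]
  refine Finset.sum_congr rfl fun i _ => ?_
  rw [ha]
  ring

lemma dotProduct_mul_transpose_mulVec (hB : IsUnit B.det) (t : Fin k → ℝ) :
    ((B⁻¹)ᵀ *ᵥ t) ⬝ᵥ ((B * Bᵀ) *ᵥ ((B⁻¹)ᵀ *ᵥ t)) = t ⬝ᵥ t := by
  have h : Bᵀ *ᵥ ((B⁻¹)ᵀ *ᵥ t) = t := by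
    rw [Matrix.mulVec_mulVec, ← Matrix.transpose_mul, Matrix.nonsing_inv_mul _ hB,
      Matrix.transpose_one, Matrix.one_mulVec]
  rw [← Matrix.mulVec_mulVec, Matrix.dotProduct_mulVec, ← Matrix.mulVec_transpose, h]

lemma mulVec_dotProduct_inv_mulVec (hB : IsUnit B.det) (z : Fin k → ℝ) :
    (B *ᵥ z) ⬝ᵥ ((B * Bᵀ)⁻¹ *ᵥ (B *ᵥ z)) = z ⬝ᵥ z := by
  rw [Matrix.mul_inv_rev, ← Matrix.mulVec_mulVec, Matrix.mulVec_mulVec z,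
    Matrix.nonsing_inv_mul _ hB, Matrix.one_mulVec, dotProduct_comm, Matrix.dotProduct_mulVec,
    ← Matrix.mulVec_transpose, Matrix.mulVec_mulVec,
    Matrix.mul_nonsing_inv _ (by rwa [Matrix.det_transpose]), Matrix.one_mulVec]

end Whiten

/-- The normalised sum of the whitened observations is `√n B⁻¹ ν_n`. At `n = 0` both sides vanish,
since `√0 = 0`. -/
lemma mulVec_sum_whiten {d k : ℕ} {S : Type*} (X : ℕ → S → EuclideanSpace ℝ (Fin d))
    (f : Fin k → EuclideanSpace ℝ (Fin d) → ℝ) (a : Fin k → ℝ)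
    {B : Matrix (Fin k) (Fin k) ℝ} (hB : IsUnit B.det) (n : ℕ) (ω : S) :
    B *ᵥ ((√n)⁻¹ • ∑ i ∈ Finset.range n, whiten f a B (X i ω)).ofLp =
      √n • fun i => a i - ∫ y, f i y ∂(empiricalMeasure (sample X n ω)) := by
  have h1 : ((√n)⁻¹ • ∑ i ∈ Finset.range n, whiten f a B (X i ω)).ofLp =
      (√n)⁻¹ • ∑ i ∈ Finset.range n, B⁻¹ *ᵥ fun j => a j - f j (X i ω) := by
    simp [whiten]
  rw [h1, ← Matrix.mulVec_sum, ← Matrix.mulVec_smul, Matrix.mulVec_mulVec,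
    Matrix.mul_nonsing_inv _ hB, Matrix.one_mulVec]
  ext j
  simp only [Pi.smul_apply, Finset.sum_apply, smul_eq_mul, Finset.sum_sub_distrib,
    integral_empiricalMeasure_sample, Finset.sum_const, Finset.card_range, nsmul_eq_mul]
  rcases Nat.eq_zero_or_pos n with rfl | hn
  · simp
  have hn' : (0 : ℝ) < n := by exact_mod_cast hn
  have hs : √(n : ℝ) * √n = n := Real.mul_self_sqrt hn'.le
  have hs' : √(n : ℝ) ≠ 0 := (Real.sqrt_pos.2 hn').ne'
  field_simp
  rw [sq, hs]

section Limit

variable {d k : ℕ} {S : Type*} [MeasurableSpace S] {μ : Measure S} [IsProbabilityMeasure μ]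
  {P : Measure (EuclideanSpace ℝ (Fin d))} [IsProbabilityMeasure P]
  {X : ℕ → S → EuclideanSpace ℝ (Fin d)} {f : Fin k → EuclideanSpace ℝ (Fin d) → ℝ}
  {a : Fin k → ℝ}

theorem tendstoInDistribution_whiten (hX : ∀ i, HasLaw (X i) P μ) (hindep : iIndepFun X μ)
    (hfm : ∀ i, Measurable (f i)) (hf : ∀ i, MemLp (f i) 2 P) (ha : ∀ i, ∫ y, f i y ∂P = a i)
    {B : Matrix (Fin k) (Fin k) ℝ} (hB : IsUnit B.det) (hcov : covMatrix f P = B * Bᵀ) :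
    TendstoInDistribution
      (fun (n : ℕ) ω => (√n)⁻¹ • ∑ i ∈ Finset.range n, whiten f a B (X i ω)) atTop id
      (fun _ => μ) (stdGaussian (EuclideanSpace ℝ (Fin k))) := by
  have hm := measurable_whiten (a := a) (B := B) hfm
  have hmap {g : EuclideanSpace ℝ (Fin d) → ℝ} (hg : AEStronglyMeasurable g P) :
      ∫ ω, g (X 0 ω) ∂μ = ∫ y, g y ∂P := by
    rw [← (hX 0).map_eq] at hg ⊢
    rw [MeasureTheory.integral_map (hX 0).aemeasurable hg]
  refine tendstoInDistribution_stdGaussian (Y := fun i ω => whiten f a B (X i ω)) ?_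
    (hindep.comp _ fun _ => hm) (fun i => (identDistrib_of_hasLaw hX i).comp hm)
    (fun t => ?_) fun t => ?_
  · have := memLp_whiten (a := a) (B := B) hf
    rw [← (hX 0).map_eq] at this
    exact this.comp_of_map (hX 0).aemeasurable
  · have hg := memLp_centredComb hf ((B⁻¹)ᵀ *ᵥ t.ofLp)
    simp only [inner_whiten ha]
    rw [integral_neg, hmap hg.aestronglyMeasurable, integral_centredComb hf, neg_zero]
  · have hg := memLp_centredComb hf ((B⁻¹)ᵀ *ᵥ t.ofLp)
    simp only [inner_whiten ha, neg_sq]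
    rw [hmap (g := fun y => centredComb f P _ y ^ 2) (hg.aestronglyMeasurable.pow 2),
      integral_centredComb_sq hf, hcov,
      dotProduct_mul_transpose_mulVec hB, EuclideanSpace.real_norm_sq_eq]
    exact Finset.sum_congr rfl fun i _ => (sq _).symm

/-- The quadratic form in the whitened vector and in `S_n⁻¹` is jointly continuous, `S_n⁻¹` tends
almost surely to the inverse covariance matrix of `P`, and the whitened vector is asymptotically
standard Gaussian, so that the limit law is that of the squared norm of a standard Gaussian vector.
-/
theorem tendstoInDistribution_quadForm (hX : ∀ i, HasLaw (X i) P μ) (hindep : iIndepFun X μ)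
    (hfm : ∀ i, Measurable (f i)) (hf : ∀ i, MemLp (f i) 2 P) (hind : LinIndepWithOne P f)
    (ha : ∀ i, ∫ y, f i y ∂P = a i) :
    TendstoInDistribution (fun (n : ℕ) ω => (n : ℝ) *
      ((fun i => a i - ∫ y, f i y ∂(empiricalMeasure (sample X n ω))) ⬝ᵥ
        ((empCov f (sample X n ω))⁻¹ *ᵥ
          fun i => a i - ∫ y, f i y ∂(empiricalMeasure (sample X n ω))))) atTop
      id (fun _ => μ) (chiSquareMeasure k) := by
  obtain ⟨B, hB, hcov⟩ := exists_eq_mul_transpose (posDef_covMatrix hf hind)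
  have hT n : AEMeasurable
      (fun ω => (fun i j => (empCov f (sample X n ω))⁻¹ i j : Fin k → Fin k → ℝ)) μ := by
    refine (measurable_matrix_inv.comp (measurable_pi_lambda _ fun i =>
      measurable_pi_lambda _ fun j => measurable_empCov hfm i j)).comp_aemeasurable
      (aemeasurable_sample hX n)
  have hTlim : TendstoInMeasure μ
      (fun n ω => (fun i j => (empCov f (sample X n ω))⁻¹ i j : Fin k → Fin k → ℝ)) atTop
      fun _ => (fun i j => (covMatrix f P)⁻¹ i j : Fin k → Fin k → ℝ) :=
    tendstoInMeasure_of_tendsto_ae (fun n => (hT n).aestronglyMeasurable)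
      (ae_tendsto_empCov_inv hX hindep hfm hf hind)
  have hcont : Continuous fun p : EuclideanSpace ℝ (Fin k) × (Fin k → Fin k → ℝ) =>
      (B *ᵥ p.1.ofLp) ⬝ᵥ (Matrix.of p.2 *ᵥ (B *ᵥ p.1.ofLp)) := by
    simp only [dotProduct, Matrix.mulVec, Matrix.of_apply]
    fun_prop
  have hlim := (tendstoInDistribution_whiten hX hindep hfm hf ha hB hcov
    ).continuous_comp_prodMk_of_tendstoInMeasure_const hcont hTlim hT
  refine (tendstoInDistribution_of_map_eq hlim aemeasurable_id ?_).congr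
    (fun n => ae_of_all _ fun ω => ?_) (ae_of_all _ fun _ => rfl)
  · rw [← map_id_chiSquareMeasure]
    congr 1
    ext z
    change (B *ᵥ z.ofLp) ⬝ᵥ ((covMatrix f P)⁻¹ *ᵥ (B *ᵥ z.ofLp)) = _
    rw [hcov, mulVec_dotProduct_inv_mulVec hB]
    exact Finset.sum_congr rfl fun i _ => (sq _).symm
  · simp only
    rw [mulVec_sum_whiten X f a hB]
    change (√(n : ℝ) • _) ⬝ᵥ ((empCov f (sample X n ω))⁻¹ *ᵥ (√(n : ℝ) • _)) = _
    rw [Matrix.mulVec_smul, smul_dotProduct, dotProduct_smul, smul_smul,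
      Real.mul_self_sqrt n.cast_nonneg, smul_eq_mul]

end Limit

end ChiSquareTest

open ChiSquareTest in
theorem mainTheorem1 {d k : ℕ} {S : Type*} [MeasurableSpace S]
    (μ : Measure S) [IsProbabilityMeasure μ]
    (P : Measure (EuclideanSpace ℝ (Fin d))) [IsProbabilityMeasure P]
    (X : ℕ → S → EuclideanSpace ℝ (Fin d))
    (hX_law : ∀ i, HasLaw (X i) P μ) (hX_indep : iIndepFun X μ)
    (f : Fin k → EuclideanSpace ℝ (Fin d) → ℝ) (a : Fin k → ℝ)
    (hf : ∀ i, Measurable (f i))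
    (hf_indep : LinIndepWithOne P f)
    (F : EuclideanSpace ℝ (Fin d) → ℝ) (hF : ∀ i x, |f i x| ≤ F x)
    (hF_sq : Integrable (fun x => F x ^ 2) P)
    (Q₀ : SignedMeasure (EuclideanSpace ℝ (Fin d))) (hQ₀ : Q₀ ∈ constraintSet f a)
    (hH0 : P.toSignedMeasure ∈ constraintSet f a) :
    -- the estimate is given by the quadratic form whenever `S_n` is invertible
    (∀ (n : ℕ) (x : Fin n → EuclideanSpace ℝ (Fin d)), 1 ≤ n → IsUnit (empCov f x) →
      chiSqEst f a x = ENNReal.ofReal (quadStat f Q₀ x)) ∧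
    -- almost surely, `S_n` is invertible for all large `n`
    (∀ᵐ ω ∂μ, ∀ᶠ n in atTop, IsUnit (empCov f (sample X n ω))) ∧
    -- convergence in distribution of `n χ²_n`, as a random variable with values in `[0, ∞]`
    TendstoInDistribution (fun (n : ℕ) ω => (n : ℝ≥0∞) * chiSqEst f a (sample X n ω)) atTop
      ENNReal.ofReal (fun _ => μ) (chiSquareMeasure k) ∧
    -- convergence in distribution of `n ν_n' S_n⁻¹ ν_n`, as a real random variable
    TendstoInDistribution (fun (n : ℕ) ω => (n : ℝ) * quadStat f Q₀ (sample X n ω)) atTop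
      id (fun _ => μ) (chiSquareMeasure k) := by
  have hQ i : ∫ᵛ y, f i y ∂<•Q₀ = a i := (hQ₀.2 i).2
  have ha i : ∫ y, f i y ∂P = a i := by
    rw [← VectorMeasure.integral_toSignedMeasure, (hH0.2 i).2]
  have hquad {n : ℕ} (x : Fin n → EuclideanSpace ℝ (Fin d)) : quadStat f Q₀ x =
      (fun i => a i - ∫ y, f i y ∂(empiricalMeasure x)) ⬝ᵥ
        ((empCov f x)⁻¹ *ᵥ fun i => a i - ∫ y, f i y ∂(empiricalMeasure x)) := by
    have : nuVec f Q₀ x = fun i => a i - ∫ y, f i y ∂(empiricalMeasure x) :=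
      funext fun i => by rw [nuVec, hQ]
    rw [quadStat, this]
  have hfin (n : ℕ) (x : Fin n → EuclideanSpace ℝ (Fin d)) (hn : 1 ≤ n)
      (hS : IsUnit (empCov f x)) : chiSqEst f a x = ENNReal.ofReal (quadStat f Q₀ x) := by
    rw [hquad, chiSqEst_eq_of_isUnit hn hS]
  have hf2 := memLp_two_of_envelope hf hF hF_sq
  have hunit := ae_eventually_isUnit_empCov hX_law hX_indep hf hf2 hf_indep
  have hlim : TendstoInDistribution (fun (n : ℕ) ω => (n : ℝ) * quadStat f Q₀ (sample X n ω))
      atTop id (fun _ => μ) (chiSquareMeasure k) := by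
    simp only [hquad]
    exact tendstoInDistribution_quadForm hX_law hX_indep hf hf2 hf_indep ha
  refine ⟨hfin, hunit, ?_, hlim⟩
  refine tendstoInDistribution_of_eventuallyEq
    (hlim.continuous_comp (g := ENNReal.ofReal) ENNReal.continuous_ofReal)
    (fun n => ((measurable_chiSqEst hf a).comp_aemeasurable
      (aemeasurable_sample hX_law n)).const_mul _) ?_
  filter_upwards [hunit] with ω hω
  filter_upwards [hω, eventually_ge_atTop 1] with n hS hn
  simp only [Function.comp_apply]
  rw [hfin n _ hn hS, ENNReal.ofReal_mul n.cast_nonneg, ENNReal.ofReal_natCast]
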